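/- Theorem. For all integers $d_1\ge 1$ and $s\ge 1$ there are constants $C>0$ and $c>0$, depending only on $d_1$ and $s$, such that the following holds for every integer $d_2\ge 1$. Let $\rho$ be a random state on $\mathbf{C}^{d_1}\otimes\mathbf{C}^{d_2}$ with distribution $\mu_{d_1d_2,s}$, that is, the distribution of the partial trace $\mathrm{tr}_{\mathbf{C}^s}|\psi\rangle\langle\psi|$, where $\psi$ is uniformly distributed on the unit sphere of $\mathbf{C}^{d_1}\otimes\mathbf{C}^{d_2}\otimes\mathbf{C}^s$. Let $\rho^R$ be the realignment of $\rho$, that is, the $d_1^2\times d_2^2$ matrix with entries $(\rho^R)_{ik,jl}=\rho_{ij,kl}$, where $\rho_{ij,kl}$ ($1\le i,k\le d_1$, $1\le j,l\le d_2$) are the entries of $\rho$ in the canonical product basis, and let $\|\cdot\|_1$ denote the trace norm (the sum of the singular values). 1. If $s<d_1^2$, then $\mathbf{P}(\|\rho^R\|_1>1)\ge 1-C\exp(-c\,d_2^{1/4})$; that is, $\rho$ violates the realignment criterion with at least this probability. 2. If $s>d_1^2$, then $\mathbf{P}(\|\rho^R\|_1\le 1)\ge 1-C\exp(-c\,d_2^{1/4})$;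 that is, $\rho$ satisfies the realignment criterion with at least this probability. -/

import Mathlib

open MeasureTheory

noncomputable section

/-- Matrices carry the product σ-algebra of their entries. -/
instance Matrix.instMeasurableSpacePi {m n α : Type*} [MeasurableSpace α] :
    MeasurableSpace (Matrix m n α) :=
  inferInstanceAs (MeasurableSpace (m → n → α))

/-- The uniform probability measure on the unit sphere of a finite-dimensional real inner product
space: the normalized surface measure. -/
def uniformSphere (E : Type*) [NormedAddCommGroup E] [InnerProductSpace ℝ E]
    [FiniteDimensional ℝ E] [MeasurableSpace E] [BorelSpace E] :
    Measure (Metric.sphere (0 : E) 1) :=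
  ((volume : Measure E).toSphere Set.univ)⁻¹ • (volume : Measure E).toSphere

/-- The rank one operator `|ψ⟩⟨ψ|`, as a matrix in the canonical basis. -/
def ketBra {ι : Type*} [Fintype ι] (ψ : EuclideanSpace ℂ ι) : Matrix ι ι ℂ :=
  Matrix.vecMulVec ψ (star ψ)

/-- The partial trace over the second factor of `ℂⁿ ⊗ ℂᵉ`. -/
def partialTraceRight {n e : Type*} [Fintype e] (M : Matrix (n × e) (n × e) ℂ) : Matrix n n ℂ :=
  Matrix.of fun a b => ∑ k, M (a, k) (b, k)

/-- The distribution `μ_{n,s}` of the partial trace over `ℂˢ` of `|ψ⟩⟨ψ|`, where `ψ` is uniformly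
distributed on the unit sphere of `ℂⁿ ⊗ ℂˢ`. The canonical basis of `ℂⁿ` is indexed by `n`. -/
def inducedState (n : Type*) [Fintype n] (s : ℕ) : Measure (Matrix n n ℂ) :=
  (uniformSphere (EuclideanSpace ℂ (n × Fin s))).map
    fun ψ : Metric.sphere (0 : EuclideanSpace ℂ (n × Fin s)) 1 =>
      partialTraceRight (ketBra (ψ : EuclideanSpace ℂ (n × Fin s)))

/-- The realignment `A^R` of an operator on `ℂ^I ⊗ ℂ^J`: its entry at `((i, k), (j, l))` is the
entry of `A` at `((i, j), (k, l))`. -/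
def realignment {I J : Type*} (A : Matrix (I × J) (I × J) ℂ) : Matrix (I × I) (J × J) ℂ :=
  Matrix.of fun p q => A (p.1, q.1) (p.2, q.2)

/-- The trace norm `‖A‖₁` of a rectangular matrix: the sum of its singular values. Mathlib's
sequence of singular values of a linear map vanishes from the dimension of the domain on. -/
def traceNorm {m n : Type*} [Fintype m] [Fintype n] [DecidableEq n] (A : Matrix m n ℂ) : ℝ :=
  ∑ i ∈ Finset.range (Fintype.card n), (Matrix.toEuclideanLin A).singularValues i

end

/-! Cut `ψ` into `d₂` blocks in `ℂ^{d₁} ⊗ ℂˢ`, and let `G` be the sum of the rank one matrices of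
the blocks. For the realigned state `A`, the matrix `A Aᴴ` is a quadratic function of `G` alone
(`realignment_mul_conjTranspose`), and its size does not depend on `d₂`. As `d₂` grows, `G`
concentrates at `1/(d₁s)`, where `A Aᴴ = (d₁²s)⁻¹ • 1` (`realignedGram_isotropic`): all `d₁²`
singular values equal `1/(d₁√s)`, with sum `d₁/√s`. This exceeds 1 exactly when `s < d₁²`.

The trace norm is bounded on both sides by expressions in `tr A Aᴴ` and `tr (A Aᴴ)²` that are sharp
at this limit (`traceNorm_ge`, `traceNorm_le`). They are continuous in `G`, so a fixed neighbourhood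
of the limit suffices.

Concentration (`exists_blockGram_concentration`) is a Chernoff bound: polar coordinates replace the
sphere by a Gaussian integral, which factors over the blocks into the `d₂`-th power of a ratio less
than 1. The rate obtained is `exp(-c d₂)`, stronger than required. -/

/-! ### Chernoff bound on the sphere -/

open Set Metric Measure in
/-- Polar coordinates for the Lebesgue integral. -/
theorem lintegral_eq_lintegral_toSphere_prod {E : Type*} [NormedAddCommGroup E] [NormedSpace ℝ E]
    [FiniteDimensional ℝ E] [Nontrivial E] [MeasurableSpace E] [BorelSpace E]
    (μ : Measure E) [μ.IsAddHaarMeasure] (f : E → ENNReal) :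
    ∫⁻ x, f x ∂μ = ∫⁻ p : sphere (0 : E) 1 × Ioi (0 : ℝ), f (p.2.1 • p.1.1)
      ∂(μ.toSphere.prod (volumeIoiPow (Module.finrank ℝ E - 1))) := by
  have h := μ.measurePreserving_homeomorphUnitSphereProd
  rw [← h.lintegral_comp_emb (homeomorphUnitSphereProd E).measurableEmbedding]
  have h2 : ∫⁻ x, f x ∂μ = ∫⁻ x in ({0}ᶜ : Set E), f x ∂μ := by
    rw [restrict_eq_self_of_ae_mem]
    simp [ae_iff]
  rw [h2, ← lintegral_subtype_comap (measurableSet_singleton _).compl]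
  refine lintegral_congr fun x => ?_
  congr 1
  exact (congrArg Subtype.val ((homeomorphUnitSphereProd E).symm_apply_apply x)).symm

open Set Metric Measure in
/-- An exponential Markov inequality transferring a Gaussian bound to the sphere. -/
theorem toSphere_nonneg_mul_lintegral_le {E : Type*} [NormedAddCommGroup E] [NormedSpace ℝ E]
    [FiniteDimensional ℝ E] [Nontrivial E] [MeasurableSpace E] [BorelSpace E]
    (μ : Measure E) [μ.IsAddHaarMeasure] {Q : E → ℝ} (hQ : Measurable Q)
    (hQ2 : ∀ (r : ℝ) (x : E), Q (r • x) = r ^ 2 * Q x) :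
    μ.toSphere {ω | 0 ≤ Q ω} * ∫⁻ x, ENNReal.ofReal (Real.exp (-‖x‖ ^ 2)) ∂μ ≤
      μ.toSphere univ * ∫⁻ x, ENNReal.ofReal (Real.exp (-‖x‖ ^ 2 + Q x)) ∂μ := by
  set K := ∫⁻ r : Ioi (0 : ℝ), ENNReal.ofReal (Real.exp (-r.1 ^ 2))
    ∂(volumeIoiPow (Module.finrank ℝ E - 1)) with hK
  have hS : MeasurableSet {ω : sphere (0 : E) 1 | 0 ≤ Q ω} :=
    measurableSet_le measurable_const (hQ.comp measurable_subtype_coe)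
  have h1 : ∫⁻ x, ENNReal.ofReal (Real.exp (-‖x‖ ^ 2)) ∂μ = μ.toSphere univ * K := by
    rw [lintegral_eq_lintegral_toSphere_prod]
    have : ∀ p : sphere (0 : E) 1 × Ioi (0 : ℝ),
        ENNReal.ofReal (Real.exp (-‖p.2.1 • p.1.1‖ ^ 2)) =
          1 * ENNReal.ofReal (Real.exp (-p.2.1 ^ 2)) := by
      intro p
      rw [norm_smul, norm_eq_of_mem_sphere]
      simp
    simp_rw [this]
    rw [lintegral_prod_mul (f := fun _ : sphere (0 : E) 1 => (1 : ENNReal))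
      (g := fun r : Ioi (0 : ℝ) => ENNReal.ofReal (Real.exp (-r.1 ^ 2)))
      aemeasurable_const (by fun_prop)]
    simp [hK]
  have h2 : μ.toSphere {ω | 0 ≤ Q ω} * K ≤
      ∫⁻ x, ENNReal.ofReal (Real.exp (-‖x‖ ^ 2 + Q x)) ∂μ := by
    rw [lintegral_eq_lintegral_toSphere_prod, ← lintegral_indicator_one hS, hK,
      ← lintegral_prod_mul ((measurable_one.indicator hS).aemeasurable) (by fun_prop)]
    -- Pointwise in polar coordinates: where `Q ω ≥ 0`, homogeneity gives `exp(-r²) ≤ exp(-r² +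
    -- Q(rω))`.
    refine lintegral_mono fun p => ?_
    by_cases hp : 0 ≤ Q p.1
    · rw [indicator_of_mem (by exact hp), Pi.one_apply, one_mul, hQ2, norm_smul,
        norm_eq_of_mem_sphere]
      refine ENNReal.ofReal_le_ofReal (Real.exp_le_exp.2 ?_)
      have : 0 ≤ p.2.1 ^ 2 * Q p.1 := by positivity
      simp only [mul_one, Real.norm_eq_abs, sq_abs]
      linarith
    · rw [indicator_of_notMem (by exact hp), zero_mul]
      exact zero_le
  rw [h1]
  calc _ = μ.toSphere univ * (μ.toSphere {ω | 0 ≤ Q ω} * K) := by ring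
    _ ≤ _ := by gcongr

/-- Integrals of products over a space that splits linearly into equal blocks. -/
theorem exists_integral_prod_eq {E V J : Type*} [NormedAddCommGroup E] [NormedSpace ℝ E]
    [FiniteDimensional ℝ E] [MeasurableSpace E] [BorelSpace E]
    (μ : Measure E) [μ.IsAddHaarMeasure] [NormedAddCommGroup V] [InnerProductSpace ℝ V]
    [FiniteDimensional ℝ V] [MeasurableSpace V] [BorelSpace V] [Fintype J]
    (L : E ≃L[ℝ] (J → V)) :
    ∃ c : NNReal, c ≠ 0 ∧ (∀ f : V → ℝ,
      ∫ x, ∏ j, f (L x j) ∂μ = c * (∫ y, f y) ^ Fintype.card J) ∧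
      ∀ f : V → ℝ, Integrable f → Integrable (fun x => ∏ j, f (L x j)) μ := by
  have : (μ.map L).IsAddHaarMeasure := L.isAddHaarMeasure_map μ
  -- Uniqueness of Haar measure; the scalar need not be computed, since it cancels in the ratio of
  -- Gaussian integrals.
  have hc : μ.map L = Measure.addHaarScalarFactor (μ.map L) volume • (volume : Measure (J → V)) :=
    Measure.isAddLeftInvariant_eq_smul (μ.map L) volume
  set c := Measure.addHaarScalarFactor (μ.map L) (volume : Measure (J → V))
  have hme : MeasurableEmbedding L := L.toHomeomorph.measurableEmbedding
  refine ⟨c, fun h0 => ?_, fun f => ?_, fun f hf => ?_⟩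
  · rw [h0, zero_smul] at hc
    exact NeZero.ne (μ.map L) hc
  · rw [← hme.integral_map (fun z : J → V => ∏ j, f (z j)), hc, integral_smul_nnreal_measure,
      integral_fintype_prod_volume_eq_pow, NNReal.smul_def, smul_eq_mul]
  · have h := Integrable.fintype_prod (μ := fun _ : J => (volume : Measure V))
      (f := fun _ => f) fun _ => hf
    have h2 : Integrable (fun z : J → V => ∏ j, f (z j)) (μ.map L) := by
      rw [hc]
      exact h.smul_measure_nnreal
    exact (hme.integrable_map_iff).1 h2

theorem integrable_exp_neg_mul_norm_sq {V : Type*} [NormedAddCommGroup V] [InnerProductSpace ℝ V]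
    [FiniteDimensional ℝ V] [MeasurableSpace V] [BorelSpace V] {b : ℝ} (hb : 0 < b) :
    Integrable fun y : V => Real.exp (-b * ‖y‖ ^ 2) := by
  refine Integrable.of_integral_ne_zero ?_
  rw [GaussianFourier.integral_rexp_neg_mul_sq_norm hb]
  positivity

/-- Large deviations on the sphere of a space split into equal orthogonal blocks. -/
theorem uniformSphere_sum_nonneg_le {E V J : Type*} [NormedAddCommGroup E] [InnerProductSpace ℝ E]
    [FiniteDimensional ℝ E] [Nontrivial E] [MeasurableSpace E] [BorelSpace E]
    [NormedAddCommGroup V] [InnerProductSpace ℝ V]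
    [FiniteDimensional ℝ V] [MeasurableSpace V] [BorelSpace V] [Fintype J]
    (L : E ≃L[ℝ] (J → V)) (hL : ∀ x, ‖x‖ ^ 2 = ∑ j, ‖L x j‖ ^ 2) {Φ : V → ℝ}
    (hΦ : Continuous Φ) (hΦ2 : ∀ (r : ℝ) (y : V), Φ (r • y) = r ^ 2 * Φ y)
    (hint : Integrable fun y => Real.exp (-‖y‖ ^ 2 + Φ y)) :
    (uniformSphere E).real {ω | 0 ≤ ∑ j, Φ (L ω j)} ≤
      ((∫ y, Real.exp (-‖y‖ ^ 2 + Φ y)) / ∫ y : V, Real.exp (-‖y‖ ^ 2)) ^ Fintype.card J := by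
  obtain ⟨c, hc, hprod, hprodint⟩ := exists_integral_prod_eq (volume : Measure E) L
  set Q : E → ℝ := fun x => ∑ j, Φ (L x j) with hQdef
  have hgauss : Integrable fun y : V => Real.exp (-‖y‖ ^ 2) := by
    simpa using integrable_exp_neg_mul_norm_sq (V := V) one_pos
  have hA : 0 < ∫ y : V, Real.exp (-‖y‖ ^ 2) := integral_exp_pos hgauss
  have hQ : Continuous Q := by fun_prop
  have hQ2 : ∀ (r : ℝ) (x : E), Q (r • x) = r ^ 2 * Q x := by
    intro r x
    simp [hQdef, hΦ2, Finset.mul_sum]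
  have key := toSphere_nonneg_mul_lintegral_le (volume : Measure E) hQ.measurable hQ2
  have e1 : ∀ x : E, Real.exp (-‖x‖ ^ 2) = ∏ j, Real.exp (-‖L x j‖ ^ 2) := by
    intro x
    rw [← Real.exp_sum, hL, Finset.sum_neg_distrib]
  have e2 : ∀ x : E, Real.exp (-‖x‖ ^ 2 + Q x) = ∏ j, Real.exp (-‖L x j‖ ^ 2 + Φ (L x j)) := by
    intro x
    rw [← Real.exp_sum, hL, Finset.sum_add_distrib, Finset.sum_neg_distrib]
  rw [← ofReal_integral_eq_lintegral_ofReal (by simp_rw [e1]; exact hprodint _ hgauss)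
      (Filter.Eventually.of_forall fun _ => (Real.exp_pos _).le),
    ← ofReal_integral_eq_lintegral_ofReal (by simp_rw [e2]; exact hprodint _ hint)
      (Filter.Eventually.of_forall fun _ => (Real.exp_pos _).le)] at key
  simp_rw [e1, e2] at key
  rw [hprod (fun y => Real.exp (-‖y‖ ^ 2)), hprod (fun y => Real.exp (-‖y‖ ^ 2 + Φ y))] at key
  have key2 := ENNReal.toReal_mono (ENNReal.mul_ne_top (measure_ne_top _ _) ENNReal.ofReal_ne_top)
    key
  have hB : 0 ≤ ∫ y : V, Real.exp (-‖y‖ ^ 2 + Φ y) :=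
    integral_nonneg fun _ => (Real.exp_pos _).le
  rw [ENNReal.toReal_mul, ENNReal.toReal_mul, ENNReal.toReal_ofReal (by positivity),
    ENNReal.toReal_ofReal (by positivity)] at key2
  have hT : 0 < ((volume : Measure E).toSphere Set.univ).toReal :=
    ENNReal.toReal_pos (Measure.measure_univ_ne_zero.2 (Measure.toSphere_ne_zero volume))
      (measure_ne_top _ _)
  have hc' : (0 : ℝ) < c := by positivity
  rw [uniformSphere, measureReal_def, Measure.smul_apply, smul_eq_mul, ENNReal.toReal_mul,
    ENNReal.toReal_inv, div_pow, le_div_iff₀ (by positivity), inv_mul_eq_div, div_mul_eq_mul_div,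
    div_le_iff₀ hT]
  refine le_of_mul_le_mul_left ?_ hc'
  linarith

/-! ### Gaussian integrals under quadratic perturbation -/

theorem integrable_of_norm_le_mul_exp {V F : Type*} [NormedAddCommGroup V] [InnerProductSpace ℝ V]
    [FiniteDimensional ℝ V] [MeasurableSpace V] [BorelSpace V] [NormedAddCommGroup F]
    {f : V → F} (hf : Continuous f) {M : ℝ}
    (hM : ∀ y, ‖f y‖ ≤ M * Real.exp (-(1 / 2) * ‖y‖ ^ 2)) : Integrable f :=
  ((integrable_exp_neg_mul_norm_sq (V := V) (b := 1 / 2) (by norm_num)).const_mul M).mono'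
    hf.aestronglyMeasurable (Filter.Eventually.of_forall hM)

theorem integrable_exp_mul_of_norm_le {V F : Type*} [NormedAddCommGroup V] [InnerProductSpace ℝ V]
    [FiniteDimensional ℝ V] [MeasurableSpace V] [BorelSpace V] [NormedAddCommGroup F]
    [NormedSpace ℝ F] {f : V → F} (hf : Continuous f) {M : ℝ} (hM : ∀ y, ‖f y‖ ≤ M * ‖y‖ ^ 2) :
    Integrable fun y => Real.exp (-‖y‖ ^ 2) • f y := by
  refine integrable_of_norm_le_mul_exp (M := 2 * |M|) (by fun_prop) fun y => ?_
  rw [norm_smul, Real.norm_eq_abs, abs_of_pos (Real.exp_pos _)]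
  have h1 : ‖y‖ ^ 2 ≤ 2 * Real.exp (1 / 2 * ‖y‖ ^ 2) := by
    linarith [Real.add_one_le_exp (1 / 2 * ‖y‖ ^ 2)]
  have h2 : Real.exp (-‖y‖ ^ 2) * Real.exp (1 / 2 * ‖y‖ ^ 2) =
      Real.exp (-(1 / 2) * ‖y‖ ^ 2) := by
    rw [← Real.exp_add]; congr 1; ring
  calc Real.exp (-‖y‖ ^ 2) * ‖f y‖ ≤ Real.exp (-‖y‖ ^ 2) * (|M| * ‖y‖ ^ 2) := by
        gcongr
        exact (hM y).trans (by gcongr; exact le_abs_self M)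
    _ ≤ Real.exp (-‖y‖ ^ 2) * (|M| * (2 * Real.exp (1 / 2 * ‖y‖ ^ 2))) := by gcongr
    _ = 2 * |M| * (Real.exp (-‖y‖ ^ 2) * Real.exp (1 / 2 * ‖y‖ ^ 2)) := by ring
    _ = _ := by rw [h2]

/-- A quadratic perturbation of negative Gaussian mean lowers the Gaussian integral. -/
theorem exists_integral_exp_neg_norm_sq_add_lt {V : Type*} [NormedAddCommGroup V]
    [InnerProductSpace ℝ V] [FiniteDimensional ℝ V] [MeasurableSpace V] [BorelSpace V]
    {Φ : V → ℝ} (hΦ : Continuous Φ) {M : ℝ} (hM : ∀ y, |Φ y| ≤ M * ‖y‖ ^ 2)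
    (hneg : ∫ y, Real.exp (-‖y‖ ^ 2) * Φ y < 0) :
    ∃ t : ℝ, 0 < t ∧ Integrable (fun y => Real.exp (-‖y‖ ^ 2 + t * Φ y)) ∧
      ∫ y, Real.exp (-‖y‖ ^ 2 + t * Φ y) < ∫ y : V, Real.exp (-‖y‖ ^ 2) := by
  set w : V → NNReal := fun y => ⟨Real.exp (-‖y‖ ^ 2), (Real.exp_pos _).le⟩ with hw
  have hwc : Continuous w := by
    refine Continuous.subtype_mk ?_ _
    fun_prop
  set m : Measure V := volume.withDensity fun y => (w y : ENNReal) with hm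
  have hint : ∀ f : V → ℝ, ∫ y, f y ∂m = ∫ y, Real.exp (-‖y‖ ^ 2) * f y := fun f => by
    rw [hm, integral_withDensity_eq_integral_smul hwc.measurable]
    rfl
  have hintble : ∀ f : V → ℝ, Integrable f m ↔ Integrable fun y => Real.exp (-‖y‖ ^ 2) * f y :=
    fun f => by
      rw [hm, integrable_withDensity_iff_integrable_smul hwc.measurable]
      rfl
  have hM0 : 0 < 2 * (|M| + 1) := by positivity
  -- For such `t` the perturbation is at most `‖y‖²/2`, so half of the Gaussian decay survives.
  have hball : ∀ t : ℝ, |t| < (2 * (|M| + 1))⁻¹ →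
      Integrable fun y => Real.exp (-‖y‖ ^ 2 + t * Φ y) := by
    intro t ht
    refine integrable_of_norm_le_mul_exp (M := 1) (by fun_prop) fun y => ?_
    rw [Real.norm_eq_abs, abs_of_pos (Real.exp_pos _), one_mul, Real.exp_le_exp]
    have h1 : t * Φ y ≤ |t| * ((|M| + 1) * ‖y‖ ^ 2) := by
      refine (le_abs_self _).trans ?_
      rw [abs_mul]
      gcongr
      exact (hM y).trans (by gcongr; linarith [le_abs_self M])
    have h2 : |t| * (2 * (|M| + 1)) ≤ 1 := by
      have := mul_le_mul_of_nonneg_right ht.le hM0.le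
      rwa [inv_mul_cancel₀ hM0.ne'] at this
    have h3 := mul_le_mul_of_nonneg_right h2 (sq_nonneg ‖y‖)
    linarith
  have hmem : ∀ t : ℝ, |t| < (2 * (|M| + 1))⁻¹ →
      t ∈ ProbabilityTheory.integrableExpSet Φ m := by
    intro t ht
    change Integrable _ m
    rw [hintble]
    simpa only [Real.exp_add] using hball t ht
  have h0 : (0 : ℝ) ∈ interior (ProbabilityTheory.integrableExpSet Φ m) := by
    rw [mem_interior_iff_mem_nhds]
    filter_upwards [Metric.ball_mem_nhds (0 : ℝ) (inv_pos.2 hM0)] with t ht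
    exact hmem t (by simpa using ht)
  -- The derivative at 0 of `t ↦ ∫ exp(-‖y‖² + tΦ)` is the Gaussian integral of `Φ`, which is
  -- negative; hence the function drops for small `t > 0`.
  have hd := ProbabilityTheory.hasDerivAt_mgf h0
  simp only [zero_mul, Real.exp_zero, mul_one] at hd
  rw [hint] at hd
  have hev := (hd.tendsto_slope_zero_right.eventually_lt_const hneg).and
    ((mem_nhdsWithin_of_mem_nhds (Metric.ball_mem_nhds (0 : ℝ) (inv_pos.2 hM0))))
  obtain ⟨t, ⟨ht1, ht2⟩, ht0⟩ := (Filter.Eventually.and hev self_mem_nhdsWithin).exists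
  have ht0 : 0 < t := ht0
  refine ⟨t, ht0, hball t (by simpa using ht2), ?_⟩
  have h3 : ProbabilityTheory.mgf Φ m t < ProbabilityTheory.mgf Φ m 0 := by
    rw [zero_add, smul_eq_mul, inv_mul_eq_div, div_lt_iff₀ ht0, zero_mul] at ht1
    linarith
  rw [ProbabilityTheory.mgf, ProbabilityTheory.mgf, hint, hint] at h3
  simpa only [Real.exp_add, zero_mul, Real.exp_zero, mul_one] using h3

/-! ### Gaussian second moments are isotropic -/

section SecondMoments

variable {K : Type*} [Fintype K] [DecidableEq K]

/-- The deviation of a second-moment entry from its isotropic value. -/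
noncomputable def momentDeviation (α β : K) (y : EuclideanSpace ℂ K) : ℂ :=
  y α * star (y β) - if α = β then ((‖y‖ ^ 2 / Fintype.card K : ℝ) : ℂ) else 0

theorem continuous_momentDeviation (α β : K) : Continuous (momentDeviation α β) := by
  unfold momentDeviation
  split_ifs <;> fun_prop

theorem norm_momentDeviation_le (α β : K) (y : EuclideanSpace ℂ K) :
    ‖momentDeviation α β y‖ ≤ 2 * ‖y‖ ^ 2 := by
  have hK : (1 : ℝ) ≤ Fintype.card K := by
    exact_mod_cast Fintype.card_pos_iff.2 ⟨α⟩
  have h1 : ‖y α * star (y β)‖ ≤ ‖y‖ ^ 2 := by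
    rw [norm_mul, norm_star, sq]
    exact mul_le_mul (PiLp.norm_apply_le y α) (PiLp.norm_apply_le y β) (norm_nonneg _)
      (norm_nonneg _)
  have h2 : ‖if α = β then ((‖y‖ ^ 2 / Fintype.card K : ℝ) : ℂ) else 0‖ ≤ ‖y‖ ^ 2 := by
    split_ifs
    · rw [Complex.norm_real, Real.norm_eq_abs, abs_of_nonneg (by positivity)]
      exact div_le_self (by positivity) hK
    · simp
  calc _ ≤ _ := norm_sub_le _ _
    _ ≤ _ := by linarith

theorem momentDeviation_smul (α β : K) (r : ℝ) (y : EuclideanSpace ℂ K) :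
    momentDeviation α β (r • y) = (r : ℂ) ^ 2 * momentDeviation α β y := by
  simp only [momentDeviation, norm_smul, PiLp.smul_apply, Complex.real_smul, star_mul']
  have : star (r : ℂ) = r := Complex.conj_ofReal r
  rw [this, mul_pow, Real.norm_eq_abs, sq_abs]
  split_ifs
  · push_cast
    ring
  · ring

theorem integral_exp_comp_isometry {V F : Type*} [NormedAddCommGroup V]
    [InnerProductSpace ℝ V] [FiniteDimensional ℝ V] [MeasurableSpace V] [BorelSpace V]
    [NormedAddCommGroup F] [NormedSpace ℝ F] (T : V ≃ₗᵢ[ℝ] V) (f : V → F) :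
    ∫ y, Real.exp (-‖y‖ ^ 2) • f (T y) = ∫ y, Real.exp (-‖y‖ ^ 2) • f y := by
  rw [← T.measurePreserving.integral_comp T.toHomeomorph.measurableEmbedding
    fun y => Real.exp (-‖y‖ ^ 2) • f y]
  simp

/-- Flipping the sign of the coordinate `α` preserves the Gaussian weight and negates the integrand.
-/
theorem integral_exp_smul_apply_mul_star_of_ne {α β : K} (h : α ≠ β) :
    ∫ y : EuclideanSpace ℂ K, Real.exp (-‖y‖ ^ 2) • (y α * star (y β)) = 0 := by
  have h1 := integral_exp_comp_isometry (LinearIsometryEquiv.piLpCongrRight 2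
    fun i => if i = α then LinearIsometryEquiv.neg ℝ else LinearIsometryEquiv.refl ℝ ℂ)
    fun y : EuclideanSpace ℂ K => y α * star (y β)
  have h2 : β ≠ α := h.symm
  simp [h2, integral_neg] at h1 ⊢
  linear_combination (-1 / 2 : ℂ) * h1

/-- Swapping coordinates shows that all diagonal moments agree, so each is their average. -/
theorem integral_exp_smul_apply_mul_star_self (α : K) :
    ∫ y : EuclideanSpace ℂ K, Real.exp (-‖y‖ ^ 2) • (y α * star (y α)) =
      ∫ y : EuclideanSpace ℂ K, Real.exp (-‖y‖ ^ 2) • ((‖y‖ ^ 2 / Fintype.card K : ℝ) : ℂ) := by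
  have hK : (Fintype.card K : ℂ) ≠ 0 := by
    have : 0 < Fintype.card K := Fintype.card_pos_iff.2 ⟨α⟩
    exact_mod_cast this.ne'
  have h1 : ∀ β, ∫ y : EuclideanSpace ℂ K, Real.exp (-‖y‖ ^ 2) • (y β * star (y β)) =
      ∫ y : EuclideanSpace ℂ K, Real.exp (-‖y‖ ^ 2) • (y α * star (y α)) := by
    intro β
    have h2 := integral_exp_comp_isometry
      (LinearIsometryEquiv.piLpCongrLeft 2 ℝ ℂ (Equiv.swap α β))
      fun y : EuclideanSpace ℂ K => y α * star (y α)
    rw [← h2]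
    simp [LinearIsometryEquiv.piLpCongrLeft_apply]
  have h3 : ∀ y : EuclideanSpace ℂ K,
      Real.exp (-‖y‖ ^ 2) • ((‖y‖ ^ 2 / Fintype.card K : ℝ) : ℂ) =
        (Fintype.card K : ℂ)⁻¹ * ∑ β, Real.exp (-‖y‖ ^ 2) • (y β * star (y β)) := by
    intro y
    rw [EuclideanSpace.norm_sq_eq]
    rw [← Finset.smul_sum]
    simp only [RCLike.star_def, RCLike.mul_conj, Complex.real_smul]
    push_cast
    rw [div_eq_mul_inv]
    exact (mul_assoc _ _ _).symm.trans (mul_comm _ _)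
  simp_rw [h3]
  rw [integral_const_mul, integral_finsetSum, Finset.sum_congr rfl fun β _ => h1 β,
    Finset.sum_const, Finset.card_univ, nsmul_eq_mul, inv_mul_cancel_left₀ hK]
  intro β _
  refine integrable_exp_mul_of_norm_le (by fun_prop) (M := 1) fun y => ?_
  rw [norm_mul, norm_star, one_mul, sq]
  exact mul_le_mul (PiLp.norm_apply_le y β) (PiLp.norm_apply_le y β) (norm_nonneg _)
    (norm_nonneg _)

theorem integral_exp_smul_momentDeviation (α β : K) :
    ∫ y, Real.exp (-‖y‖ ^ 2) • momentDeviation α β y = 0 := by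
  by_cases h : α = β
  · subst h
    simp only [momentDeviation, if_true, smul_sub]
    rw [integral_sub, integral_exp_smul_apply_mul_star_self, sub_self]
    · refine integrable_exp_mul_of_norm_le (by fun_prop) (M := 1) fun y => ?_
      rw [norm_mul, norm_star, one_mul, sq]
      exact mul_le_mul (PiLp.norm_apply_le y α) (PiLp.norm_apply_le y α) (norm_nonneg _)
        (norm_nonneg _)
    · refine integrable_exp_mul_of_norm_le (by fun_prop) (M := (Fintype.card K : ℝ)⁻¹)
        fun y => ?_
      rw [Complex.norm_real, Real.norm_eq_abs, abs_of_nonneg (by positivity), inv_mul_eq_div]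
  · simpa only [momentDeviation, if_neg h, sub_zero] using
      integral_exp_smul_apply_mul_star_of_ne h

/-- The tested deviation in the direction `u`, lowered by `ε`. -/
noncomputable def deviationForm (α β : K) (u : ℂ) (ε : ℝ) (y : EuclideanSpace ℂ K) : ℝ :=
  (u * momentDeviation α β y).re - ε * ‖y‖ ^ 2

theorem continuous_deviationForm (α β : K) (u : ℂ) (ε : ℝ) :
    Continuous (deviationForm α β u ε) := by
  have := continuous_momentDeviation α β
  exact (Complex.continuous_re.comp (continuous_const.mul this)).sub (by fun_prop)

theorem deviationForm_smul (α β : K) (u : ℂ) (ε : ℝ) (r : ℝ) (y : EuclideanSpace ℂ K) :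
    deviationForm α β u ε (r • y) = r ^ 2 * deviationForm α β u ε y := by
  rw [deviationForm, deviationForm, momentDeviation_smul, norm_smul, mul_left_comm,
    ← Complex.ofReal_pow, Complex.re_ofReal_mul, Real.norm_eq_abs, mul_pow, sq_abs]
  ring

theorem abs_deviationForm_le (α β : K) (u : ℂ) (ε : ℝ) (y : EuclideanSpace ℂ K) :
    |deviationForm α β u ε y| ≤ (2 * ‖u‖ + |ε|) * ‖y‖ ^ 2 := by
  have h1 : |(u * momentDeviation α β y).re| ≤ ‖u‖ * (2 * ‖y‖ ^ 2) := by
    refine (Complex.abs_re_le_norm _).trans ?_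
    rw [norm_mul]
    gcongr
    exact norm_momentDeviation_le α β y
  have h2 : |ε * ‖y‖ ^ 2| = |ε| * ‖y‖ ^ 2 := by
    rw [abs_mul, abs_of_nonneg (sq_nonneg ‖y‖)]
  have h3 := norm_sub_le (u * momentDeviation α β y).re (ε * ‖y‖ ^ 2)
  simp only [Real.norm_eq_abs] at h3
  rw [deviationForm]
  linarith

/-- The deviation has Gaussian mean zero, so only the strictly negative term `-ε‖y‖²` contributes.
This is the hypothesis of the Chernoff bound. -/
theorem integral_exp_mul_deviationForm_neg (α β : K) (u : ℂ) {ε : ℝ} (hε : 0 < ε) :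
    ∫ y, Real.exp (-‖y‖ ^ 2) * deviationForm α β u ε y < 0 := by
  have hint := integrable_exp_mul_of_norm_le (continuous_momentDeviation α β)
    (norm_momentDeviation_le α β)
  have hint2 : Integrable fun y : EuclideanSpace ℂ K => Real.exp (-‖y‖ ^ 2) * ‖y‖ ^ 2 :=
    integrable_exp_mul_of_norm_le (f := fun y : EuclideanSpace ℂ K => ‖y‖ ^ 2) (by fun_prop)
      (M := 1) fun y => by simp
  have h1 : ∀ y, Real.exp (-‖y‖ ^ 2) * deviationForm α β u ε y =
      RCLike.re (u * (Real.exp (-‖y‖ ^ 2) • momentDeviation α β y)) -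
        ε * (Real.exp (-‖y‖ ^ 2) * ‖y‖ ^ 2) := by
    intro y
    rw [deviationForm, mul_smul_comm]
    simp only [RCLike.smul_re, RCLike.re_to_complex]
    ring
  simp_rw [h1]
  rw [integral_sub (hint.const_mul u).re (hint2.const_mul ε), integral_re (hint.const_mul u),
    integral_const_mul, integral_const_mul, integral_exp_smul_momentDeviation, mul_zero]
  have h2 : 0 < ∫ y : EuclideanSpace ℂ K, Real.exp (-‖y‖ ^ 2) * ‖y‖ ^ 2 := by
    have : Nontrivial (EuclideanSpace ℂ K) :=
      have : Nonempty K := ⟨α⟩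
      inferInstance
    obtain ⟨y, hy⟩ := exists_ne (0 : EuclideanSpace ℂ K)
    exact integral_pos_of_integrable_nonneg_nonzero (x := y) (by fun_prop) hint2
      (fun _ => by positivity) (by simpa using hy)
  simp
  positivity

end SecondMoments

/-! ### Trace norm versus traces of powers of `A Aᴴ` -/

section TraceNorm

variable {m n : Type*} [Fintype m] [Fintype n] [DecidableEq n]

theorem trace_toEuclideanLin (B : Matrix n n ℂ) :
    LinearMap.trace ℂ _ (Matrix.toEuclideanLin B) = B.trace := by
  rw [Matrix.toEuclideanLin_eq_toLin_orthonormal, Matrix.trace_toLin_eq]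

theorem adjoint_comp_toEuclideanLin [DecidableEq m] (A : Matrix m n ℂ) :
    (Matrix.toEuclideanLin A).adjoint ∘ₗ Matrix.toEuclideanLin A =
      Matrix.toEuclideanLin (A.conjTranspose * A) := by
  rw [← Matrix.toEuclideanLin_conjTranspose_eq_adjoint, Matrix.toLpLin_mul (q := 2)]

/-- The sum of squared singular values is the squared Hilbert–Schmidt norm. -/
theorem sum_singularValues_sq (A : Matrix m n ℂ) :
    ∑ i ∈ Finset.range (Fintype.card n), (Matrix.toEuclideanLin A).singularValues i ^ 2 =
      (Matrix.trace (A * A.conjTranspose)).re := by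
  classical
  set T := Matrix.toEuclideanLin A with hT
  have hn : Module.finrank ℂ (EuclideanSpace ℂ n) = Fintype.card n := finrank_euclideanSpace
  have h1 := T.isSymmetric_adjoint_comp_self.re_trace_eq_sum_eigenvalues hn
  rw [Finset.sum_range]
  simp_rw [T.sq_singularValues_fin hn]
  rw [← h1, hT, adjoint_comp_toEuclideanLin, trace_toEuclideanLin, Matrix.trace_mul_comm]
  rfl

theorem sum_singularValues_pow_four (A : Matrix m n ℂ) :
    ∑ i ∈ Finset.range (Fintype.card n), (Matrix.toEuclideanLin A).singularValues i ^ 4 =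
      (Matrix.trace (A * A.conjTranspose * (A * A.conjTranspose))).re := by
  classical
  set T := Matrix.toEuclideanLin A with hT
  have hn : Module.finrank ℂ (EuclideanSpace ℂ n) = Fintype.card n := finrank_euclideanSpace
  set S := T.isSymmetric_adjoint_comp_self
  have h1 := LinearMap.trace_eq_sum_inner ((T.adjoint ∘ₗ T) ∘ₗ (T.adjoint ∘ₗ T))
    (S.eigenvectorBasis hn)
  have h2 : ∀ i, T.singularValues (i : Fin (Fintype.card n)) ^ 4 = S.eigenvalues hn i ^ 2 := by
    intro i
    rw [← T.sq_singularValues_fin hn]; ring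
  rw [Finset.sum_range]
  simp_rw [h2]
  have h3 : ∀ i, inner ℂ (S.eigenvectorBasis hn i)
      (((T.adjoint ∘ₗ T) ∘ₗ (T.adjoint ∘ₗ T)) (S.eigenvectorBasis hn i)) =
        ((S.eigenvalues hn i ^ 2 : ℝ) : ℂ) := by
    intro i
    rw [LinearMap.comp_apply, S.apply_eigenvectorBasis, map_smul, S.apply_eigenvectorBasis,
      inner_smul_right, inner_smul_right, OrthonormalBasis.inner_eq_one]
    simp [sq]
  have h4 : LinearMap.trace ℂ _ ((T.adjoint ∘ₗ T) ∘ₗ (T.adjoint ∘ₗ T)) =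
      (A.conjTranspose * A * (A.conjTranspose * A)).trace := by
    rw [hT, adjoint_comp_toEuclideanLin, ← Matrix.toLpLin_mul, trace_toEuclideanLin]
  rw [Finset.sum_congr rfl fun i _ => h3 i, h4, ← Complex.ofReal_sum] at h1
  rw [← Complex.ofReal_re (∑ i, _), ← h1, Matrix.mul_assoc, Matrix.trace_mul_comm]
  simp only [Matrix.mul_assoc]

/-- Each `σ ≥ 0` dominates a quartic in `σ` touching it at `σ = x`: the difference has the double
root `x` and otherwise nonnegative factors. Equality holds when all singular values lie in `{0, x}`.
-/
theorem traceNorm_ge (A : Matrix m n ℂ) {x : ℝ} (hx : 0 < x) :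
    3 / (2 * x) * (Matrix.trace (A * A.conjTranspose)).re -
      1 / (2 * x ^ 3) * (Matrix.trace (A * A.conjTranspose * (A * A.conjTranspose))).re ≤
      traceNorm A := by
  rw [← sum_singularValues_sq, ← sum_singularValues_pow_four, Finset.mul_sum, Finset.mul_sum,
    ← Finset.sum_sub_distrib]
  refine Finset.sum_le_sum fun i _ => ?_
  set σ := (Matrix.toEuclideanLin A).singularValues i
  have hσ : 0 ≤ σ := LinearMap.singularValues_nonneg _ i
  have h : σ - (3 / (2 * x) * σ ^ 2 - 1 / (2 * x ^ 3) * σ ^ 4) =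
      σ * (σ - x) ^ 2 * (σ + 2 * x) / (2 * x ^ 3) := by
    field_simp
    ring
  have : 0 ≤ σ * (σ - x) ^ 2 * (σ + 2 * x) / (2 * x ^ 3) := by positivity
  linarith

/-- AM-GM, `σ ≤ x/2 + σ²/(2x)`, with equality at `σ = x`. The constant term is paid only for indices
below the number of rows, which bounds the rank, so the estimate stays uniform in the number of
columns. -/
theorem traceNorm_le (A : Matrix m n ℂ) {x : ℝ} (hx : 0 < x) :
    traceNorm A ≤ Fintype.card m * x / 2 + (Matrix.trace (A * A.conjTranspose)).re / (2 * x) := by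
  set T := Matrix.toEuclideanLin A with hT
  have hr : Module.finrank ℂ T.range ≤ Fintype.card m := by
    simpa using Submodule.finrank_le T.range
  have h1 : ∀ i ∈ Finset.range (Fintype.card n), T.singularValues i ≤
      (if i < Fintype.card m then x / 2 else 0) + T.singularValues i ^ 2 / (2 * x) := by
    intro i _
    split_ifs with h
    · have : x / 2 + T.singularValues i ^ 2 / (2 * x) - T.singularValues i =
          (T.singularValues i - x) ^ 2 / (2 * x) := by
        field_simp
        ring
      have : 0 ≤ (T.singularValues i - x) ^ 2 / (2 * x) := by positivity
      linarith
    · rw [T.singularValues_eq_zero_iff_le_finrank_range.2 (hr.trans (not_lt.1 h))]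
      simp
  have h2 : ∑ i ∈ Finset.range (Fintype.card n), (if i < Fintype.card m then x / 2 else 0) ≤
      Fintype.card m * x / 2 := by
    rw [← Finset.sum_filter, Finset.sum_const, nsmul_eq_mul, mul_div_assoc]
    gcongr
    calc _ ≤ (Finset.range (Fintype.card m)).card := Finset.card_le_card fun i => by
            simp
      _ = _ := Finset.card_range _
  calc traceNorm A ≤ _ := Finset.sum_le_sum h1
    _ ≤ _ := by
      rw [Finset.sum_add_distrib, ← Finset.sum_div, sum_singularValues_sq]
      linarith

end TraceNorm

/-! ### Block decomposition and the Gram matrix -/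

section Blocks

variable {I J S : Type*} [Fintype I] [Fintype J] [Fintype S]

/-- The splitting of a vector of `ℂ^I ⊗ ℂ^J ⊗ ℂ^S` into `J` blocks in `ℂ^I ⊗ ℂ^S`. -/
noncomputable def blockEquiv (I J S : Type*) [Fintype I] [Fintype J] [Fintype S] :
    EuclideanSpace ℂ ((I × J) × S) ≃L[ℝ] (J → EuclideanSpace ℂ (I × S)) :=
  LinearEquiv.toContinuousLinearEquiv
    { toFun := fun ψ j => WithLp.toLp 2 fun α => ψ ((α.1, j), α.2)
      invFun := fun f => WithLp.toLp 2 fun p => f p.1.2 (p.1.1, p.2)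
      map_add' := fun _ _ => rfl
      map_smul' := fun _ _ => rfl
      left_inv := fun _ => rfl
      right_inv := fun _ => rfl }

theorem blockEquiv_apply (ψ : EuclideanSpace ℂ ((I × J) × S)) (j : J) (α : I × S) :
    blockEquiv I J S ψ j α = ψ ((α.1, j), α.2) := rfl

theorem norm_sq_eq_sum_blockEquiv (ψ : EuclideanSpace ℂ ((I × J) × S)) :
    ‖ψ‖ ^ 2 = ∑ j, ‖blockEquiv I J S ψ j‖ ^ 2 := by
  simp only [EuclideanSpace.norm_sq_eq, blockEquiv_apply, Fintype.sum_prod_type]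
  exact Finset.sum_comm

/-- The Gram matrix of the vectors of `ℂ^J` that make up a tensor. -/
noncomputable def blockGram (ψ : EuclideanSpace ℂ ((I × J) × S)) (α β : I × S) : ℂ :=
  ∑ j, blockEquiv I J S ψ j α * star (blockEquiv I J S ψ j β)

/-- The matrix `A Aᴴ`, for `A` the realigned state, in terms of the Gram matrix. -/
noncomputable def realignedGram (G : I × S → I × S → ℂ) : Matrix (I × I) (I × I) ℂ :=
  Matrix.of fun p q => ∑ a, ∑ b, G (p.1, a) (q.1, b) * star (G (p.2, a) (q.2, b))

theorem realignment_mul_conjTranspose (ψ : EuclideanSpace ℂ ((I × J) × S)) :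
    realignment (partialTraceRight (ketBra ψ)) *
      (realignment (partialTraceRight (ketBra ψ))).conjTranspose =
        realignedGram (blockGram ψ) := by
  ext p q
  simp only [Matrix.mul_apply, Matrix.conjTranspose_apply, realignment, partialTraceRight, ketBra,
    Matrix.of_apply, Matrix.vecMulVec_apply, realignedGram, blockGram, blockEquiv_apply,
    Fintype.sum_prod_type, star_sum, star_mul', star_star, Finset.sum_mul_sum, Pi.star_apply]
  -- Summing over `J` first turns the products of entries into products of Gram entries.
  have h : ∀ f : J → J → S → S → ℂ,
      ∑ j, ∑ l, ∑ a, ∑ b, f j l a b = ∑ a, ∑ b, ∑ j, ∑ l, f j l a b := by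
    intro f
    simp only [← Fintype.sum_prod_type']
    rw [← Equiv.sum_comp (⟨fun x => (x.2.2.1, x.2.2.2, x.1, x.2.1),
      fun x => (x.2.2.1, x.2.2.2, x.1, x.2.1), fun _ => rfl, fun _ => rfl⟩ :
        S × S × J × J ≃ J × J × S × S)]
    rfl
  rw [h]
  refine Finset.sum_congr rfl fun a _ => Finset.sum_congr rfl fun b _ =>
    Finset.sum_congr rfl fun j _ => Finset.sum_congr rfl fun l _ => ?_
  simp
  ring

omit [Fintype I] in
theorem continuous_realignedGram :
    Continuous (realignedGram : (I × S → I × S → ℂ) → Matrix (I × I) (I × I) ℂ) := by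
  refine continuous_matrix fun p q => ?_
  simp only [realignedGram, Matrix.of_apply]
  fun_prop

variable [DecidableEq I] [DecidableEq S]

theorem realignedGram_isotropic [Nonempty I] [Nonempty S] :
    realignedGram (fun α β : I × S => if α = β then ((Fintype.card (I × S) : ℂ))⁻¹ else 0) =
      ((Fintype.card I : ℂ) ^ 2 * Fintype.card S)⁻¹ • (1 : Matrix (I × I) (I × I) ℂ) := by
  have hS : (Fintype.card S : ℂ) ≠ 0 := by exact_mod_cast Fintype.card_ne_zero
  have hI : (Fintype.card I : ℂ) ≠ 0 := by exact_mod_cast Fintype.card_ne_zero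
  ext ⟨i, k⟩ ⟨i', k'⟩
  simp only [realignedGram, Matrix.of_apply, Prod.mk.injEq, Matrix.smul_apply, Matrix.one_apply,
    Fintype.card_prod, smul_eq_mul]
  by_cases h1 : i = i' <;> by_cases h2 : k = k' <;> simp [h1, h2]
  field_simp

theorem exists_one_lt_of_continuous {K : Type*} [Fintype K] {F : (K → K → ℂ) → ℝ}
    (hF : Continuous F) {G₀ : K → K → ℂ} (h : 1 < F G₀) :
    ∃ ε : ℝ, 0 < ε ∧ ∀ G, (∀ α β, ‖G α β - G₀ α β‖ < ε) → 1 < F G := by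
  obtain ⟨ε, hε, hsub⟩ := Metric.mem_nhds_iff.1 (hF.continuousAt.eventually_const_lt h)
  refine ⟨ε, hε, fun G hG => hsub ?_⟩
  rw [Metric.mem_ball, dist_pi_lt_iff hε]
  intro α
  rw [dist_pi_lt_iff hε]
  intro β
  rw [dist_eq_norm]
  exact hG α β

theorem sum_deviationForm_blockEquiv {ψ : EuclideanSpace ℂ ((I × J) × S)} (hψ : ‖ψ‖ = 1)
    (α β : I × S) (u : ℂ) (ε : ℝ) :
    ∑ j, deviationForm α β u ε (blockEquiv I J S ψ j) =
      (u * (blockGram ψ α β - if α = β then (Fintype.card (I × S) : ℂ)⁻¹ else 0)).re - ε := by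
  have h := norm_sq_eq_sum_blockEquiv ψ
  rw [hψ, one_pow] at h
  simp only [deviationForm, momentDeviation]
  rw [Finset.sum_sub_distrib, ← Finset.mul_sum, ← h, mul_one, ← Complex.re_sum, ← Finset.mul_sum,
    Finset.sum_sub_distrib, blockGram]
  congr 5
  split_ifs
  · rw [← Complex.ofReal_sum, ← Finset.sum_div, ← h]
    push_cast
    rw [one_div]
  · simp

/-- One of `|re z|`, `|im z|` is at least `ε/2`, and multiplying by a power of `I` makes it the real
part. Four linear tests thus detect a large complex number. -/
theorem exists_half_le_re_I_pow_mul {z : ℂ} {ε : ℝ} (h : ε ≤ ‖z‖) :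
    ∃ u : Fin 4, ε / 2 ≤ (Complex.I ^ (u : ℕ) * z).re := by
  have h1 := h.trans (Complex.norm_le_abs_re_add_abs_im z)
  by_contra! hu
  have h2 := hu 0
  have h3 := hu 1
  have h4 := hu 2
  have h5 := hu 3
  simp [pow_succ] at h2 h3 h4 h5
  rcases abs_cases z.re with h | h <;> rcases abs_cases z.im with h' | h' <;> linarith

end Blocks

/-! ### Concentration of the Gram matrix and transfer to states -/

instance isProbabilityMeasure_uniformSphere (E : Type*) [NormedAddCommGroup E]
    [InnerProductSpace ℝ E] [FiniteDimensional ℝ E] [Nontrivial E] [MeasurableSpace E]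
    [BorelSpace E] : IsProbabilityMeasure (uniformSphere E) :=
  have : NeZero (volume : Measure E).toSphere := ⟨Measure.toSphere_ne_zero volume⟩
  isProbabilityMeasureSMul

theorem measurable_partialTraceRight_ketBra (n : Type*) [Fintype n] (s : ℕ) :
    Measurable fun ψ : Metric.sphere (0 : EuclideanSpace ℂ (n × Fin s)) 1 =>
      partialTraceRight (ketBra (ψ : EuclideanSpace ℂ (n × Fin s))) := by
  refine measurable_pi_iff.2 fun a => measurable_pi_iff.2 fun b => Continuous.measurable ?_
  simp only [partialTraceRight, ketBra, Matrix.of_apply, Matrix.vecMulVec_apply, Pi.star_apply]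
  fun_prop

/-- Only the inequality for preimages under a pushforward is used, so neither `P` nor `bad` has to
be measurable. -/
theorem le_inducedState_real {n : Type*} [Fintype n] [Nonempty n] {s : ℕ} [NeZero s]
    {P : Set (Matrix n n ℂ)} {bad : Set (Metric.sphere (0 : EuclideanSpace ℂ (n × Fin s)) 1)}
    (h : ∀ ψ, ψ ∉ bad → partialTraceRight (ketBra (ψ : EuclideanSpace ℂ (n × Fin s))) ∈ P) :
    1 - (uniformSphere (EuclideanSpace ℂ (n × Fin s))).real bad ≤ (inducedState n s).real P := by
  have hm := measurable_partialTraceRight_ketBra n s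
  have : IsProbabilityMeasure (inducedState n s) :=
    Measure.isProbabilityMeasure_map hm.aemeasurable
  set μ := uniformSphere (EuclideanSpace ℂ (n × Fin s))
  have h1 : μ.real badᶜ ≤ (inducedState n s).real P :=
    ENNReal.toReal_mono (measure_ne_top _ _)
      ((measure_mono h).trans (Measure.le_map_apply hm.aemeasurable P))
  have h2 : 1 ≤ μ.real bad + μ.real badᶜ := by
    have := measureReal_union_le (μ := μ) bad badᶜ
    rwa [Set.union_compl_self, probReal_univ] at this
  linarith

/-- A union bound over matrix entries and the four directions `I ^ u`, with the Chernoff bound for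
each. The block space does not involve `J`, so neither do the tests, their number or their ratios.
-/
theorem exists_blockGram_concentration (I S : Type*) [Fintype I] [Fintype S] [DecidableEq I]
    [DecidableEq S] [Nonempty I] [Nonempty S] {ε : ℝ} (hε : 0 < ε) :
    ∃ C c : ℝ, 0 < C ∧ 0 < c ∧ ∀ (J : Type) [Fintype J] [Nonempty J],
      (uniformSphere (EuclideanSpace ℂ ((I × J) × S))).real
        {ψ | ∃ α β : I × S, ε ≤ ‖blockGram (ψ : EuclideanSpace ℂ ((I × J) × S)) α β -
          if α = β then (Fintype.card (I × S) : ℂ)⁻¹ else 0‖} ≤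
        C * Real.exp (-c * Fintype.card J) := by
  let Idx := (I × S) × (I × S) × Fin 4
  have hex : ∀ τ : Idx, ∃ Φ : EuclideanSpace ℂ (I × S) → ℝ, Continuous Φ ∧
      (∀ (r : ℝ) y, Φ (r • y) = r ^ 2 * Φ y) ∧
      Integrable (fun y => Real.exp (-‖y‖ ^ 2 + Φ y)) ∧
      ∫ y, Real.exp (-‖y‖ ^ 2 + Φ y) < ∫ y : EuclideanSpace ℂ (I × S), Real.exp (-‖y‖ ^ 2) ∧
      ∃ t > 0, ∀ y, Φ y = t * deviationForm τ.1 τ.2.1 (Complex.I ^ (τ.2.2 : ℕ)) (ε / 2) y := by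
    intro τ
    set Ψ := deviationForm τ.1 τ.2.1 (Complex.I ^ (τ.2.2 : ℕ)) (ε / 2)
    have hc : Continuous Ψ := continuous_deviationForm _ _ _ _
    obtain ⟨t, ht, h1, h2⟩ := exists_integral_exp_neg_norm_sq_add_lt hc
      (abs_deviationForm_le _ _ _ _) (integral_exp_mul_deviationForm_neg _ _ _ (half_pos hε))
    refine ⟨fun y => t * Ψ y, by fun_prop, fun r y => ?_, h1, h2, t, ht, fun _ => rfl⟩
    change t * Ψ (r • y) = r ^ 2 * (t * Ψ y)
    rw [show Ψ (r • y) = r ^ 2 * Ψ y from deviationForm_smul _ _ _ _ r y]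
    ring
  choose Φ hΦ hΦ2 hΦint hΦlt t ht hΦeq using hex
  set A := ∫ y : EuclideanSpace ℂ (I × S), Real.exp (-‖y‖ ^ 2) with hA
  have hApos : 0 < A := by
    refine integral_exp_pos ?_
    simpa using integrable_exp_neg_mul_norm_sq (V := EuclideanSpace ℂ (I × S)) one_pos
  set q : Idx → ℝ := fun τ => (∫ y, Real.exp (-‖y‖ ^ 2 + Φ τ y)) / A with hq
  have hqpos : ∀ τ, 0 < q τ := fun τ => div_pos (integral_exp_pos (hΦint τ)) hApos
  obtain ⟨τ₀, hτ₀⟩ := Finite.exists_max q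
  have hlt : q τ₀ < 1 := (div_lt_one hApos).2 (hΦlt τ₀)
  -- `C` counts the tests, and `c` makes `exp(-c)` the worst ratio `q τ₀ < 1`.
  refine ⟨Fintype.card Idx, -Real.log (q τ₀), by exact_mod_cast Fintype.card_pos,
    by linarith [Real.log_neg (hqpos τ₀) hlt], fun J _ _ => ?_⟩
  have hexp : Real.exp (- -Real.log (q τ₀) * Fintype.card J) = q τ₀ ^ Fintype.card J := by
    rw [neg_neg, mul_comm, Real.exp_nat_mul, Real.exp_log (hqpos τ₀)]
  rw [hexp]
  calc _ ≤ (uniformSphere (EuclideanSpace ℂ ((I × J) × S))).real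
        (⋃ τ : Idx, {ψ | 0 ≤ ∑ j, Φ τ (blockEquiv I J S ψ j)}) := by
        refine measureReal_mono ?_
        rintro ψ ⟨α, β, h⟩
        obtain ⟨u, hu⟩ := exists_half_le_re_I_pow_mul h
        refine Set.mem_iUnion.2 ⟨(α, β, u), ?_⟩
        simp only [Set.mem_ofPred_eq, hΦeq]
        rw [← Finset.mul_sum, sum_deviationForm_blockEquiv (norm_eq_of_mem_sphere ψ)]
        exact mul_nonneg (ht _).le (sub_nonneg.2 hu)
    _ ≤ ∑ τ : Idx, (uniformSphere (EuclideanSpace ℂ ((I × J) × S))).real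
          {ψ | 0 ≤ ∑ j, Φ τ (blockEquiv I J S ψ j)} := measureReal_iUnion_fintype_le _
    _ ≤ ∑ τ : Idx, q τ₀ ^ Fintype.card J := by
        refine Finset.sum_le_sum fun τ _ => ?_
        refine (uniformSphere_sum_nonneg_le (blockEquiv I J S) norm_sq_eq_sum_blockEquiv (hΦ τ)
          (hΦ2 τ) (hΦint τ)).trans ?_
        exact pow_le_pow_left₀ (hqpos τ).le (hτ₀ τ) _
    _ = _ := by simp

theorem exists_inducedState_concentration (I : Type*) [Fintype I] [DecidableEq I] [Nonempty I]
    (s : ℕ) [NeZero s] {F : (I × Fin s → I × Fin s → ℂ) → ℝ} (hF : Continuous F)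
    (h : 1 < F fun α β => if α = β then (Fintype.card (I × Fin s) : ℂ)⁻¹ else 0) :
    ∃ C c : ℝ, 0 < C ∧ 0 < c ∧ ∀ (J : Type) [Fintype J] [Nonempty J]
      (P : Set (Matrix (I × J) (I × J) ℂ)),
      (∀ ψ : EuclideanSpace ℂ ((I × J) × Fin s), 1 < F (blockGram ψ) →
        partialTraceRight (ketBra ψ) ∈ P) →
      1 - C * Real.exp (-c * Fintype.card J) ≤ (inducedState (I × J) s).real P := by
  obtain ⟨ε, hε, hG⟩ := exists_one_lt_of_continuous hF h
  obtain ⟨C, c, hC, hc, hbound⟩ := exists_blockGram_concentration I (Fin s) hε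
  refine ⟨C, c, hC, hc, fun J _ _ P hP => ?_⟩
  refine le_trans (by linarith [hbound J]) (le_inducedState_real
    (bad := {ψ | ∃ α β : I × Fin s, ε ≤ ‖blockGram (ψ : EuclideanSpace ℂ ((I × J) × Fin s)) α β -
          if α = β then (Fintype.card (I × Fin s) : ℂ)⁻¹ else 0‖}) fun ψ hψ => hP ψ (hG _ ?_))
  intro α β
  by_contra hcon
  exact hψ ⟨α, β, not_lt.1 hcon⟩

/-! ### Values at the isotropic point and the threshold -/

theorem exp_neg_mul_le_exp_neg_mul_rpow {c : ℝ} (hc : 0 < c) {d : ℕ} (hd : 0 < d) :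
    Real.exp (-c * d) ≤ Real.exp (-c * (d : ℝ) ^ (1 / 4 : ℝ)) := by
  have h : (d : ℝ) ^ (1 / 4 : ℝ) ≤ d :=
    Real.rpow_le_self_of_one_le (by exact_mod_cast hd) (by norm_num)
  rw [Real.exp_le_exp]
  nlinarith

theorem trace_realignedGram_isotropic (d s : ℕ) [NeZero d] [NeZero s] :
    (realignedGram fun α β : Fin d × Fin s =>
      if α = β then (Fintype.card (Fin d × Fin s) : ℂ)⁻¹ else 0).trace.re = 1 / s := by
  have hd : (d : ℂ) ≠ 0 := by exact_mod_cast NeZero.ne d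
  have hs : (s : ℂ) ≠ 0 := by exact_mod_cast NeZero.ne s
  rw [realignedGram_isotropic, Matrix.trace_smul, Matrix.trace_one]
  have : (((Fintype.card (Fin d) : ℂ) ^ 2 * Fintype.card (Fin s))⁻¹ •
      (Fintype.card (Fin d × Fin d) : ℂ)) = ((1 / s : ℝ) : ℂ) := by
    simp
    field_simp
  rw [this, Complex.ofReal_re]

theorem trace_realignedGram_sq_isotropic (d s : ℕ) [NeZero d] [NeZero s] :
    (realignedGram (fun α β : Fin d × Fin s =>
        if α = β then (Fintype.card (Fin d × Fin s) : ℂ)⁻¹ else 0) *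
      realignedGram fun α β : Fin d × Fin s =>
        if α = β then (Fintype.card (Fin d × Fin s) : ℂ)⁻¹ else 0).trace.re =
      1 / (d ^ 2 * s ^ 2) := by
  have hd : (d : ℂ) ≠ 0 := by exact_mod_cast NeZero.ne d
  have hs : (s : ℂ) ≠ 0 := by exact_mod_cast NeZero.ne s
  rw [realignedGram_isotropic, Matrix.smul_mul, Matrix.mul_smul, Matrix.one_mul, smul_smul,
    Matrix.trace_smul, Matrix.trace_one]
  have : (((Fintype.card (Fin d) : ℂ) ^ 2 * Fintype.card (Fin s))⁻¹ *
      ((Fintype.card (Fin d) : ℂ) ^ 2 * Fintype.card (Fin s))⁻¹) •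
      (Fintype.card (Fin d × Fin d) : ℂ) = ((1 / (d ^ 2 * s ^ 2) : ℝ) : ℂ) := by
    simp
    field_simp
  rw [this, Complex.ofReal_re]

/-- **Threshold for the realignment criterion** on unbalanced bipartite systems. -/
theorem mainTheorem6 (d₁ s : ℕ) (hd₁ : 0 < d₁) (hs : 0 < s) :
    ∃ C c : ℝ, 0 < C ∧ 0 < c ∧ ∀ d₂ : ℕ, 0 < d₂ →
      (s < d₁ ^ 2 →
        (inducedState (Fin d₁ × Fin d₂) s).real {ρ | 1 < traceNorm (realignment ρ)} ≥
          1 - C * Real.exp (-c * (d₂ : ℝ) ^ (1 / 4 : ℝ))) ∧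
      (d₁ ^ 2 < s →
        (inducedState (Fin d₁ × Fin d₂) s).real {ρ | traceNorm (realignment ρ) ≤ 1} ≥
          1 - C * Real.exp (-c * (d₂ : ℝ) ^ (1 / 4 : ℝ))) := by
  have : NeZero d₁ := ⟨hd₁.ne'⟩
  have : NeZero s := ⟨hs.ne'⟩
  have hd : (0 : ℝ) < d₁ := by exact_mod_cast hd₁
  have hs' : (0 : ℝ) < s := by exact_mod_cast hs
  have hr : 0 < √(s : ℝ) := Real.sqrt_pos.2 hs'
  have hrs : (s : ℝ) = √(s : ℝ) ^ 2 := (Real.sq_sqrt hs'.le).symm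
  -- The common singular value at the isotropic Gram matrix, where both trace norm bounds become
  -- `d₁/√s`.
  set x : ℝ := 1 / (d₁ * √(s : ℝ)) with hx
  have hx0 : 0 < x := by positivity
  have hcont := continuous_realignedGram (I := Fin d₁) (S := Fin s)
  rcases lt_trichotomy s (d₁ ^ 2) with hlt | heq | hgt
  · have hF : Continuous fun G : Fin d₁ × Fin s → Fin d₁ × Fin s → ℂ =>
        3 / (2 * x) * (realignedGram G).trace.re -
          1 / (2 * x ^ 3) * (realignedGram G * realignedGram G).trace.re := by
      fun_prop
    obtain ⟨C, c, hC, hc, h⟩ := exists_inducedState_concentration (Fin d₁) s hF (by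
      simp only [trace_realignedGram_isotropic, trace_realignedGram_sq_isotropic]
      have h1 : √(s : ℝ) < d₁ := by
        rw [Real.sqrt_lt' hd]
        exact_mod_cast hlt
      have h2 : 3 / (2 * x) * (1 / s) - 1 / (2 * x ^ 3) * (1 / (d₁ ^ 2 * s ^ 2)) =
          d₁ / √(s : ℝ) := by
        rw [hx]
        generalize √(s : ℝ) = r at *
        rw [hrs]
        field_simp
        ring
      rw [h2]
      exact (one_lt_div hr).2 h1)
    refine ⟨C, c, hC, hc, fun d₂ hd₂ => ⟨fun _ => ?_, fun h' => absurd hlt h'.not_gt⟩⟩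
    have : NeZero d₂ := ⟨hd₂.ne'⟩
    have key := h (Fin d₂) {ρ | 1 < traceNorm (realignment ρ)} fun ψ hψ => by
      rw [← realignment_mul_conjTranspose] at hψ
      exact hψ.trans_le (traceNorm_ge _ hx0)
    rw [Fintype.card_fin] at key
    have := mul_le_mul_of_nonneg_left (exp_neg_mul_le_exp_neg_mul_rpow hc hd₂) hC.le
    linarith
  · exact ⟨1, 1, one_pos, one_pos, fun d₂ _ =>
      ⟨fun h => absurd heq h.ne, fun h => absurd heq h.ne'⟩⟩
  · have hF : Continuous fun G : Fin d₁ × Fin s → Fin d₁ × Fin s → ℂ =>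
        -- Reflected about 1, so that `1 < F G` says that the upper bound on the trace norm is less
        -- than 1.
        2 - (Fintype.card (Fin d₁ × Fin d₁) * x / 2 + (realignedGram G).trace.re / (2 * x)) := by
      fun_prop
    obtain ⟨C, c, hC, hc, h⟩ := exists_inducedState_concentration (Fin d₁) s hF (by
      simp only [trace_realignedGram_isotropic]
      have h1 : d₁ < √(s : ℝ) := by
        rw [Real.lt_sqrt hd.le]
        exact_mod_cast hgt
      have h2 : (Fintype.card (Fin d₁ × Fin d₁) : ℝ) * x / 2 + 1 / s / (2 * x) =
          d₁ / √(s : ℝ) := by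
        rw [hx, Fintype.card_prod, Fintype.card_fin]
        push_cast
        generalize √(s : ℝ) = r at *
        rw [hrs]
        field_simp
        ring
      rw [h2]
      have := (div_lt_one hr).2 h1
      linarith)
    refine ⟨C, c, hC, hc, fun d₂ hd₂ => ⟨fun h' => absurd hgt h'.not_gt, fun _ => ?_⟩⟩
    have : NeZero d₂ := ⟨hd₂.ne'⟩
    have key := h (Fin d₂) {ρ | traceNorm (realignment ρ) ≤ 1} fun ψ hψ => by
      rw [← realignment_mul_conjTranspose] at hψ
      refine (traceNorm_le _ hx0).trans ?_
      linarith
    rw [Fintype.card_fin] at key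
    have := mul_le_mul_of_nonneg_left (exp_neg_mul_le_exp_neg_mul_rpow hc hd₂) hC.le
    linarith
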